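/- All graphs are finite and simple. For a graph $\Gamma$ with vertex set $V$ and $v\in V$, let $N[v]$ be the closed neighborhood of $v$ (that is, $v$ together with its neighbors). The RA matrix $C_\Gamma$ is the integer matrix with columns indexed by $V$ whose rows are the $0/1$ indicator vectors of the sets $N[v]$ ($v\in V$) and $N[u]\cap N[v]$ ($u,v\in V$). The nullity of an integer matrix is the rank over $\mathbb Z$ of its right kernel, and its elementary divisors are the diagonal entries of its Smith normal form over $\mathbb Z$; they are nontrivial if they are different from $1$. For $m\ge 1$ the crown graph $\mathrm{Cr}(2m)$ has vertices $1,\dots,m,1',\dots,m'$, and its edges are the pairs $\{i,j'\}$ with $i\ne j$. For $N\ge 2$ the binary graph $\mathrm{Bg}(N)$ has as vertices the numbers $0,\dots,N-1$ and $\lceil\log_2 N\rceil$ bit positions; any two numbers are adjacent, any two bit positions are adjacent, and a number is adjacent to a bit position exactly when its binary expansion has a $1$ there. Let $z(N)$ be the nullity of $C_{\mathrm{Bg}(N)}$. The pyramid over a graph is obtained by adding one vertex adjacent to all its vertices. Theorem. Let $n\ge 0$, let $d_1\mid d_2\mid\cdots\mid d_n$ be integers with all $d_i\ge 2$, and let $r\ge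 0$ be an integer. Then there is a connected graph $\Gamma$ such that $C_\Gamma$ has nullity $r$ and the nontrivial nonzero elementary divisors of $C_\Gamma$ are precisely $d_1,\dots,d_n$ (with multiplicity). Moreover, there is an $N\ge 2$ with $z(N)=r$, and if $n\ge 1$ then, for every such $N$, the pyramid over the disjoint union of $\mathrm{Cr}(2d_1+4),\dots,\mathrm{Cr}(2d_n+4)$ and $\mathrm{Bg}(N)$ is such a graph $\Gamma$; if $n\ge 1$ and $r=0$, so is the pyramid over the disjoint union of $\mathrm{Cr}(2d_1+4),\dots,\mathrm{Cr}(2d_n+4)$ alone. -/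

import Mathlib

namespace RAGraph

/-! ### The RA matrix of a graph -/

/-- The closed neighborhood `N[v] = N(v) ∪ {v}`. -/
def closedNbhd {V : Type} (Γ : SimpleGraph V) (v : V) : Set V :=
  insert v (Γ.neighborSet v)

/-- The bit vector of a set `S` of vertices: the sum of the `e_v` for `v ∈ S`. -/
noncomputable def bitVector {V : Type} (S : Set V) : V → ℤ :=
  S.indicator 1

/-- The RA matrix `C_Γ`: its columns are indexed by the vertices, and its rows are the bit vectors
of `N[v]` for all vertices `v` and of `N[u] ∩ N[v]` for all pairs of vertices `(u, v)`. -/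
noncomputable def raMatrix {V : Type} (Γ : SimpleGraph V) : Matrix (V ⊕ V × V) V ℤ :=
  Matrix.of fun row => match row with
    | Sum.inl v => bitVector (closedNbhd Γ v)
    | Sum.inr (u, v) => bitVector (closedNbhd Γ u ∩ closedNbhd Γ v)

/-! ### Nullity and elementary divisors of an integer matrix -/

/-- The rank of the right kernel of an integer matrix. -/
noncomputable def nullity {m n : Type} [Fintype n] (A : Matrix m n ℤ) : ℕ :=
  Module.finrank ℤ (LinearMap.ker A.mulVecLin)

/-- `L` is the list of all elementary divisors of `A` (ones and zeros included), i.e. the diagonal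
of a Smith normal form of `A`: each entry of `L` divides the next one, and `P * A * Q` is, for some
matrices `P`, `Q` that are invertible over `ℤ`, and after an enumeration of its rows and columns,
the (rectangular) diagonal matrix with diagonal `L`. -/
def HasElementaryDivisors {m n : Type} [Fintype m] [Fintype n] [DecidableEq m] [DecidableEq n]
    (A : Matrix m n ℤ) (L : List ℕ) : Prop :=
  L.length = min (Fintype.card m) (Fintype.card n) ∧ L.IsChain (· ∣ ·) ∧
    ∃ (P : GL m ℤ) (Q : GL n ℤ) (e : m ≃ Fin (Fintype.card m)) (f : n ≃ Fin (Fintype.card n)),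
      ∀ (i : m) (j : n), ((P : Matrix m m ℤ) * A * (Q : Matrix n n ℤ)) i j =
        if (e i : ℕ) = (f j : ℕ) then ((L.getD (e i : ℕ) 0 : ℕ) : ℤ) else 0

/-- The elementary divisors of `A` other than `0` and `1` are precisely the entries of `L`, in
this order and with these multiplicities. -/
def HasNontrivialNonzeroElementaryDivisors {m n : Type} [Fintype m] [Fintype n] [DecidableEq m]
    [DecidableEq n] (A : Matrix m n ℤ) (L : List ℕ) : Prop :=
  ∃ L' : List ℕ, HasElementaryDivisors A L' ∧ L'.filter (fun x => x ≠ 0 ∧ x ≠ 1) = L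

/-! ### The graphs of the construction -/

/-- The crown graph `Cr(2m)` on the `2m` vertices `1, …, m, 1', …, m'`, in which `i` and `j'` are
adjacent precisely when `i ≠ j`, and there are no other edges. -/
def crownGraph (m : ℕ) : SimpleGraph (Fin m ⊕ Fin m) where
  Adj x y := match x, y with
    | Sum.inl i, Sum.inr j => i ≠ j
    | Sum.inr i, Sum.inl j => i ≠ j
    | _, _ => False
  symm := ⟨by rintro (i | i) (j | j) h <;> first | exact h | exact Ne.symm h⟩
  loopless := ⟨by rintro (i | i) h <;> exact h⟩

/-- The binary graph `Bg(N)`: a clique on the numbers `0, …, N - 1` and a clique on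
`⌈log₂ N⌉` bit positions, where a number is adjacent to a bit position precisely when its binary
expansion has a `1` there. -/
def binaryGraph (N : ℕ) : SimpleGraph (Fin N ⊕ Fin (Nat.clog 2 N)) where
  Adj x y := match x, y with
    | Sum.inl k, Sum.inl l => k ≠ l
    | Sum.inr i, Sum.inr j => i ≠ j
    | Sum.inl k, Sum.inr i => (k : ℕ).testBit (i : ℕ) = true
    | Sum.inr i, Sum.inl k => (k : ℕ).testBit (i : ℕ) = true
  symm := ⟨by rintro (i | i) (j | j) h <;> first | exact h | exact Ne.symm h⟩
  loopless := ⟨by rintro (i | i) h <;> exact h rfl⟩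

/-- `z(N)`, the nullity of the RA matrix of the binary graph `Bg(N)`. -/
noncomputable def binaryNullity (N : ℕ) : ℕ :=
  nullity (raMatrix (binaryGraph N))

/-- The disjoint union of a family of graphs. -/
def disjointUnion {ι : Type} {V : ι → Type} (G : ∀ i, SimpleGraph (V i)) :
    SimpleGraph (Σ i, V i) where
  Adj x y := ∃ (i : ι) (a b : V i), x = ⟨i, a⟩ ∧ y = ⟨i, b⟩ ∧ (G i).Adj a b
  symm := ⟨by rintro _ _ ⟨i, a, b, rfl, rfl, h⟩; exact ⟨i, b, a, rfl, rfl, h.symm⟩⟩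
  loopless := ⟨by
    rintro _ ⟨i, a, b, rfl, hb, h⟩
    cases hb
    exact (G i).irrefl h⟩

/-- The join of two graphs: their disjoint union, with every vertex of the first joined to every
vertex of the second. -/
def join {V W : Type} (G : SimpleGraph V) (H : SimpleGraph W) : SimpleGraph (V ⊕ W) where
  Adj x y := match x, y with
    | Sum.inl a, Sum.inl b => G.Adj a b
    | Sum.inr a, Sum.inr b => H.Adj a b
    | _, _ => True
  symm := ⟨by
    rintro (a | a) (b | b) h
    · exact SimpleGraph.Adj.symm (G := G) h
    · trivial
    · trivial
    · exact SimpleGraph.Adj.symm (G := H) h⟩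
  loopless := ⟨by
    rintro (a | a) h
    · exact G.irrefl h
    · exact H.irrefl h⟩

/-- The pyramid over a graph: its join with the one-vertex graph `K₁`. -/
def pyramid {V : Type} (G : SimpleGraph V) : SimpleGraph (Unit ⊕ V) :=
  join (⊥ : SimpleGraph Unit) G

end RAGraph

namespace RAGraph

open scoped Matrix

/-! ### Smith normal forms from the row lattice -/

/-! Nullity and elementary divisors depend only on the lattice spanned by the rows. If an
automorphism of `ℤ^V` takes it to the product of the `a i • ℤ`, the nullity counts the zeros among
the `a i`, and the entries other than `0` and `1` are the nontrivial divisors once they form a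
divisibility chain (`nullity_eq_of_isDiagonal`,
`hasNontrivialNonzeroElementaryDivisors_of_isDiagonal`). So everything reduces to computing row
lattices.

For a disjoint union the lattice is the direct sum. A pyramid adds a summand `ℤ` for the apex,
provided that the base has the all-ones vector in its lattice and two vertices with disjoint closed
neighborhoods (`mem_rowLattice_pyramid`); a pair `i`, `i'` of any crown graph supplies the latter.
For `Cr(2d+4)` the lattice is the set of vectors whose coordinate sums over the two sides agree
modulo `d` (`mem_rowLattice_crownGraph`), so it contributes exactly one nontrivial divisor, `d`.

For `Bg(N)` the bit positions split off as a free summand. On the numbers there remain the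
indicators of the supersets of a binary mask with at most two ones. The indicators for all masks
below `N` form a unitriangular matrix, so these are part of a basis, and the nullity is the number
of `k < N` with at least three ones. This count grows by at most one at each step and is unbounded,
so it takes every value `r`. Without crowns (`n = 0`) the binary graph itself is the required graph.
-/

/-- Two maps from a free module of finite rank with the same range differ by an automorphism. -/
theorem exists_linearEquiv_of_range_eq {m M : Type} [Finite m] [AddCommGroup M]
    [Module.Free ℤ M] [Module.Finite ℤ M] (α β : (m → ℤ) →ₗ[ℤ] M)
    (h : LinearMap.range α = LinearMap.range β) :
    ∃ E : (m → ℤ) ≃ₗ[ℤ] (m → ℤ), ∀ x, α (E x) = β x := by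
  -- The range is a submodule of a free `ℤ`-module of finite rank, hence projective, so the map onto
  -- it has a section `s`.
  have split : ∀ γ : (m → ℤ) →ₗ[ℤ] M, ∃ F : (m → ℤ) ≃ₗ[ℤ]
      LinearMap.ker γ × LinearMap.range γ, ∀ x, ((F x).2 : M) = γ x := by
    intro γ
    obtain ⟨s, hs⟩ := Module.projective_lifting_property γ.rangeRestrict LinearMap.id
      γ.surjective_rangeRestrict
    have hs' : ∀ y, γ (s y) = y := fun y => congrArg Subtype.val (LinearMap.congr_fun hs y)
    refine ⟨LinearEquiv.ofLinearMap
      (LinearMap.prod (LinearMap.codRestrict (LinearMap.ker γ)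
        (LinearMap.id - s ∘ₗ γ.rangeRestrict) (fun x => by simp [hs'])) γ.rangeRestrict)
      (LinearMap.coprod (LinearMap.ker γ).subtype s) ?_ ?_, fun x => rfl⟩
    · ext x
      · have : γ.rangeRestrict x = 0 := Subtype.ext x.2
        simp [this]
      · simp
      · have : γ.rangeRestrict (s x) = x := LinearMap.congr_fun hs x
        simp [this]
      · simp [hs']
    · ext x
      simp
  obtain ⟨F, hF⟩ := split α
  obtain ⟨G, hG⟩ := split β
  -- By rank–nullity the kernels have equal rank; being free, they are isomorphic.
  have hk : Module.finrank ℤ (LinearMap.ker β) = Module.finrank ℤ (LinearMap.ker α) := by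
    have h1 := α.ker.finrank_quotient_add_finrank
    have h2 := β.ker.finrank_quotient_add_finrank
    rw [α.quotKerEquivRange.finrank_eq] at h1
    rw [β.quotKerEquivRange.finrank_eq] at h2
    rw [h] at h1
    omega
  let K := LinearEquiv.ofFinrankEq (LinearMap.ker β) (LinearMap.ker α) hk
  let J := LinearEquiv.ofEq (LinearMap.range β) (LinearMap.range α) h.symm
  refine ⟨G.trans ((K.prodCongr J).trans F.symm), fun x => ?_⟩
  rw [← hF, ← hG]
  simp [J]

/-- In suitable coordinates, the submodule `R` of `ℤ^V` consists of the vectors whose `i`-th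
coordinate is divisible by `a i` for all `i`. -/
def IsDiagonal {V ι : Type} (R : Submodule ℤ (V → ℤ)) (a : ι → ℕ) : Prop :=
  ∃ Q : (V → ℤ) ≃ₗ[ℤ] (ι → ℤ), ∀ x, x ∈ R ↔ ∀ i, (a i : ℤ) ∣ Q x i

/-- The lattice spanned by the rows of an integer matrix. -/
def rowSpan {m n : Type} (A : Matrix m n ℤ) : Submodule ℤ (n → ℤ) :=
  Submodule.span ℤ (Set.range A)

theorem range_vecMulLinear_eq_rowSpan {m n : Type} [Fintype m] (A : Matrix m n ℤ) :
    LinearMap.range A.vecMulLinear = rowSpan A := by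
  classical
  refine le_antisymm ?_ (Submodule.span_le.2 ?_)
  · rintro _ ⟨x, rfl⟩
    rw [Matrix.vecMulLinear_apply, Matrix.vecMul_eq_sum]
    exact Submodule.sum_mem _ fun i _ =>
      Submodule.smul_mem _ _ (Submodule.subset_span ⟨i, rfl⟩)
  · rintro _ ⟨i, rfl⟩
    exact ⟨Pi.single i 1, by rw [Matrix.vecMulLinear_apply, Matrix.single_one_vecMul]; rfl⟩

/-- The column transformation is the given change of coordinates. After it, `A` and the diagonal
matrix have the same row lattice, so they differ by an automorphism on the row side. The bound `hmn`
leaves room for a diagonal entry in every column. -/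
theorem hasElementaryDivisors_of_isDiagonal {m n ι : Type} [Fintype m] [Fintype n]
    [DecidableEq m] [DecidableEq n] [Fintype ι] (A : Matrix m n ℤ)
    (hmn : Fintype.card n ≤ Fintype.card m) {a : ι → ℕ} (hA : IsDiagonal (rowSpan A) a)
    (L : List ℕ) (hL : L.IsChain (· ∣ ·)) (g : ι ≃ Fin L.length) (hg : ∀ i, L.get (g i) = a i) :
    HasElementaryDivisors A L := by
  obtain ⟨Q, hQ⟩ := hA
  have hcard : Fintype.card n = L.length := by
    have := Q.finrank_eq
    simp only [Module.finrank_pi] at this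
    rw [this, Fintype.card_congr g, Fintype.card_fin]
  let f : n ≃ Fin (Fintype.card n) := Fintype.equivFin n
  let e : m ≃ Fin (Fintype.card m) := Fintype.equivFin m
  let c : n ≃ ι := f.trans ((finCongr hcard).trans g.symm)
  have hLc : ∀ j, L.getD (f j : ℕ) 0 = a (c j) := by
    intro j
    rw [← hg]
    have : (f j : ℕ) < L.length := hcard ▸ (f j).2
    rw [List.getD_eq_getElem _ _ this]
    simp [c]
  let Q' : (n → ℤ) ≃ₗ[ℤ] (n → ℤ) := Q.trans (LinearEquiv.funCongrLeft ℤ ℤ c)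
  have hQ' : ∀ x, x ∈ rowSpan A ↔ ∀ j, (a (c j) : ℤ) ∣ Q' x j := by
    intro x
    rw [hQ, ← c.forall_congr_right]
    rfl
  let D : Matrix m n ℤ := Matrix.of fun i j =>
    if (e i : ℕ) = (f j : ℕ) then ((L.getD (e i : ℕ) 0 : ℕ) : ℤ) else 0
  let r : n → m := fun j => e.symm (Fin.castLE hmn (f j))
  have hr : ∀ i j, (e i : ℕ) = (f j : ℕ) ↔ i = r j := by
    intro i j
    rw [Equiv.eq_symm_apply, Fin.ext_iff]
    rfl
  have hD : ∀ x j, (x ᵥ* D) j = x (r j) * a (c j) := by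
    intro x j
    rw [Matrix.vecMul, dotProduct, Finset.sum_eq_single (r j)]
    · have := (hr (r j) j).2 rfl
      simp [D, this, ← hLc]
    · intro i _ hi
      have := mt (hr i j).1 hi
      simp [D, this]
    · simp
  have hrange : LinearMap.range (Q'.toLinearMap ∘ₗ A.vecMulLinear) =
      LinearMap.range D.vecMulLinear := by
    rw [LinearMap.range_comp, range_vecMulLinear_eq_rowSpan]
    ext y
    constructor
    · rintro ⟨x, hx, rfl⟩
      choose k hk using (hQ' x).1 hx
      have hrinj : Function.Injective r := fun j j' hj => by
        simpa [r, Fin.ext_iff, Fin.val_inj] using hj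
      -- The quotient for column `j` goes to its diagonal row `r j`; the surplus rows of `D` vanish
      -- and get coefficient `0`.
      refine ⟨Function.extend r k 0, ?_⟩
      ext j
      simp only [Matrix.vecMulLinear_apply, hD, hrinj.extend_apply]
      rw [mul_comm]
      exact (hk j).symm
    · rintro ⟨x, rfl⟩
      refine ⟨Q'.symm (x ᵥ* D), ?_, by simp⟩
      refine (hQ' _).2 fun j => ?_
      rw [LinearEquiv.apply_symm_apply, hD]
      exact Dvd.intro_left _ rfl
  obtain ⟨E, hE⟩ := exists_linearEquiv_of_range_eq _ _ hrange
  -- Transposes appear because both automorphisms act on row vectors from the right.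
  let toGL : ∀ {k : Type} [Fintype k] [DecidableEq k], ((k → ℤ) ≃ₗ[ℤ] (k → ℤ)) → GL k ℤ :=
    fun F => ⟨(LinearMap.toMatrix' F.toLinearMap)ᵀ, (LinearMap.toMatrix' F.symm.toLinearMap)ᵀ,
      by rw [← Matrix.transpose_mul, ← LinearMap.toMatrix'_comp]; simp,
      by rw [← Matrix.transpose_mul, ← LinearMap.toMatrix'_comp]; simp⟩
  refine ⟨by omega, hL, toGL E, toGL Q', e, f, fun i j => ?_⟩
  have h1 : ∀ x : n → ℤ, x ᵥ* (LinearMap.toMatrix' Q'.toLinearMap)ᵀ = Q' x := by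
    intro x
    rw [Matrix.vecMul_transpose, LinearMap.toMatrix'_mulVec]
    rfl
  have h2 : (LinearMap.toMatrix' E.toLinearMap)ᵀ i = E (Pi.single i 1) := by
    ext k
    simp [LinearMap.toMatrix'_apply]
  have h3 := congrFun (hE (Pi.single i 1)) j
  simp only [LinearMap.comp_apply, Matrix.vecMulLinear_apply, Matrix.single_one_vecMul] at h3
  change (((LinearMap.toMatrix' E.toLinearMap)ᵀ * A) * (LinearMap.toMatrix' Q'.toLinearMap)ᵀ) i j
    = D i j
  rw [Matrix.mul_apply_eq_vecMul, Matrix.mul_apply_eq_vecMul, h1, h2]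
  exact h3

/-- The kernel is the orthogonal complement of the row lattice, which is spanned by the `a i • b i`
for the basis `b` belonging to `Q`. In the coordinates `b i ⬝ᵥ y` it is therefore cut out by the
vanishing of those with `a i ≠ 0`. -/
theorem nullity_eq_of_isDiagonal {m n ι : Type} [Fintype n] [Fintype ι]
    (A : Matrix m n ℤ) {a : ι → ℕ} (hA : IsDiagonal (rowSpan A) a) :
    nullity A = Fintype.card {i // a i = 0} := by
  classical
  obtain ⟨Q, hQ⟩ := hA
  let b : Module.Basis ι ℤ (n → ℤ) := .ofEquivFun Q
  let T : (n → ℤ) ≃ₗ[ℤ] (ι → ℤ) :=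
    ((Pi.basisFun ℤ n).constr (M' := ℤ) ℤ).trans (b.constr ℤ).symm
  have hT : ∀ y i, T y i = b i ⬝ᵥ y := by
    intro y i
    change (Pi.basisFun ℤ n).constr ℤ y (b i) = _
    simp [Module.Basis.constr_apply_fintype, dotProduct]
  have hker : ∀ y, y ∈ LinearMap.ker A.mulVecLin ↔ ∀ i, a i = 0 ∨ T y i = 0 := by
    intro y
    have h1 : y ∈ LinearMap.ker A.mulVecLin ↔ ∀ x ∈ rowSpan A, x ⬝ᵥ y = 0 := by
      rw [LinearMap.mem_ker, Matrix.mulVecLin_apply]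
      constructor
      · intro h x hx
        induction hx using Submodule.span_induction with
        | mem x hx => obtain ⟨i, rfl⟩ := hx; exact congrFun h i
        | zero => simp
        | add x z _ _ hx hz => rw [add_dotProduct, hx, hz, add_zero]
        | smul c x _ hx => rw [smul_dotProduct, hx, smul_zero]
      · intro h
        ext i
        exact h _ (Submodule.subset_span ⟨i, rfl⟩)
    rw [h1]
    constructor
    · intro h i
      have := h ((a i : ℤ) • b i) ((hQ _).2 fun j => by
        rw [map_smul]
        by_cases hij : i = j <;> simp [b, hij])
      rw [smul_dotProduct, ← hT] at this
      simpa using this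
    · intro h x hx
      rw [← b.sum_equivFun x, sum_dotProduct]
      refine Finset.sum_eq_zero fun i _ => ?_
      rw [smul_dotProduct, ← hT]
      rcases h i with h | h
      · have := (hQ x).1 hx i
        rw [h] at this
        have h0 : Q x i = 0 := by simpa using this
        simp [b, h0]
      · simp [h]
  let U : LinearMap.ker A.mulVecLin ≃ₗ[ℤ] ({i // a i = 0} → ℤ) :=
    { toFun := fun y i => T y i
      map_add' := fun x y => by ext; simp
      map_smul' := fun c x => by ext; rw [Submodule.coe_smul, map_smul]; rfl
      invFun := fun z => ⟨T.symm fun i => if h : a i = 0 then z ⟨i, h⟩ else 0, by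
        rw [hker]
        intro i
        by_cases h : a i = 0 <;> simp [h]⟩
      left_inv := fun y => by
        ext1
        change T.symm _ = _
        rw [LinearEquiv.symm_apply_eq]
        ext i
        by_cases h : a i = 0
        · simp [h]
        · simp [h, ((hker y).1 y.2 i).resolve_left h]
      right_inv := fun z => by
        ext i
        simp [i.2] }
  rw [nullity, U.finrank_eq, Module.finrank_pi]

theorem hasNontrivialNonzeroElementaryDivisors_of_isDiagonal {m n ι : Type} [Fintype m]
    [Fintype n] [DecidableEq m] [DecidableEq n] [Fintype ι] (A : Matrix m n ℤ)
    (hmn : Fintype.card n ≤ Fintype.card m) {a : ι → ℕ} (hA : IsDiagonal (rowSpan A) a)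
    {k : ℕ} (d : Fin k → ℕ) (hdvd : ∀ i j : Fin k, i ≤ j → d i ∣ d j)
    (σ : Fin k → ι) (hσ : Function.Injective σ) (hσd : ∀ i, a (σ i) = d i)
    (hσa : ∀ i, (a i ≠ 0 ∧ a i ≠ 1) ↔ i ∈ Set.range σ) :
    HasNontrivialNonzeroElementaryDivisors A (List.ofFn d) := by
  classical
  let p := Fintype.card {i // a i = 1}
  let q := Fintype.card {i // a i = 0}
  let e₁ : {i // a i = 1} ≃ Fin p := Fintype.equivFin _
  let e₀ : {i // a i = 0} ≃ Fin q := Fintype.equivFin _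
  -- The order is ones, then `d`, then zeros: a divisibility chain, since `1` divides everything and
  -- everything divides `0`.
  let F : (Fin p ⊕ Fin k) ⊕ Fin q → ι :=
    Sum.elim (Sum.elim (fun i => e₁.symm i) σ) (fun i => e₀.symm i)
  have h1 : ∀ i, a (e₁.symm i) = 1 := fun i => (e₁.symm i).2
  have h0 : ∀ i, a (e₀.symm i) = 0 := fun i => (e₀.symm i).2
  have hs : ∀ i, a (σ i) ≠ 0 ∧ a (σ i) ≠ 1 := fun i => (hσa _).2 ⟨i, rfl⟩
  have hF : Function.Bijective F := by
    constructor
    · rintro ((i | i) | i) ((j | j) | j) h <;> simp only [F, Sum.elim_inl, Sum.elim_inr] at h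
      · simpa [Subtype.val_inj] using h
      · exact absurd (h ▸ h1 i) (hs j).2
      · have := h1 i; rw [h, h0] at this; omega
      · exact absurd (h ▸ h1 j) (hs i).2
      · rw [hσ h]
      · exact absurd (h ▸ h0 j) (hs i).1
      · have := h1 j; rw [← h, h0] at this; omega
      · exact absurd (h ▸ h0 i) (hs j).1
      · simpa [Subtype.val_inj] using h
    · intro i
      by_cases hi1 : a i = 1
      · exact ⟨.inl (.inl (e₁ ⟨i, hi1⟩)), by simp [F]⟩
      by_cases hi0 : a i = 0
      · exact ⟨.inr (e₀ ⟨i, hi0⟩), by simp [F]⟩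
      obtain ⟨j, rfl⟩ := (hσa i).1 ⟨hi0, hi1⟩
      exact ⟨.inl (.inr j), rfl⟩
  let G : ι ≃ Fin (p + k + q) := (Equiv.ofBijective F hF).symm.trans
    ((finSumFinEquiv.sumCongr (Equiv.refl _)).trans finSumFinEquiv)
  let v : Fin (p + k + q) → ℕ := Fin.append (Fin.append (fun _ => 1) d) (fun _ => 0)
  have hv : ∀ i, v (G i) = a i := by
    intro i
    obtain ⟨j, rfl⟩ := (Equiv.ofBijective F hF).surjective i
    rcases j with (j | j) | j <;>
      simp only [G, v, Equiv.trans_apply, Equiv.symm_apply_apply] <;> simp [F, h0, h1, hσd]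
  have hvL : List.ofFn v = List.replicate p 1 ++ List.ofFn d ++ List.replicate q 0 := by
    simp only [v, List.ofFn_fin_append, List.ofFn_const]
  refine ⟨List.ofFn v, hasElementaryDivisors_of_isDiagonal A hmn hA _ ?_
    (G.trans (finCongr (List.length_ofFn).symm)) fun i => ?_, ?_⟩
  · rw [List.isChain_iff_pairwise, hvL]
    rw [List.pairwise_append, List.pairwise_append]
    refine ⟨⟨?_, ?_, ?_⟩, ?_, ?_⟩
    · simp [List.pairwise_replicate]
    · rw [List.pairwise_ofFn]
      exact fun i j hij => hdvd i j hij.le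
    · intro x hx y _
      rw [List.eq_of_mem_replicate hx]
      exact one_dvd y
    · simp [List.pairwise_replicate]
    · intro x _ y hy
      rw [List.eq_of_mem_replicate hy]
      exact dvd_zero x
  · simp [hv]
  · have hd : ∀ x ∈ List.ofFn d, x ≠ 0 ∧ x ≠ 1 := by
      intro x hx
      obtain ⟨i, rfl⟩ := (List.mem_ofFn' d x).1 hx
      exact hσd i ▸ hs i
    have hd' : (List.ofFn d).filter (fun x => x ≠ 0 ∧ x ≠ 1) = List.ofFn d :=
      List.filter_eq_self.2 (by simpa only [decide_eq_true_eq] using hd)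
    rw [hvL, List.filter_append, List.filter_append, hd']
    simp

theorem isDiagonal_top {V : Type} : IsDiagonal (⊤ : Submodule ℤ (V → ℤ)) (fun _ : V => 1) :=
  ⟨LinearEquiv.refl ℤ _, fun x => by simp⟩

theorem IsDiagonal.sum {V W ι κ : Type} {R : Submodule ℤ (V → ℤ)} {S : Submodule ℤ (W → ℤ)}
    {T : Submodule ℤ (V ⊕ W → ℤ)} {a : ι → ℕ} {b : κ → ℕ} (hR : IsDiagonal R a)
    (hS : IsDiagonal S b) (hT : ∀ x, x ∈ T ↔ x ∘ Sum.inl ∈ R ∧ x ∘ Sum.inr ∈ S) :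
    IsDiagonal T (Sum.elim a b) := by
  obtain ⟨P, hP⟩ := hR
  obtain ⟨Q, hQ⟩ := hS
  refine ⟨(LinearEquiv.sumArrowLequivProdArrow V W ℤ ℤ).trans
    ((P.prodCongr Q).trans (LinearEquiv.sumArrowLequivProdArrow ι κ ℤ ℤ).symm), fun x => ?_⟩
  rw [hT, hP, hQ, Sum.forall]
  rfl

theorem IsDiagonal.sigma {τ : Type} {V ι : τ → Type} {R : ∀ t, Submodule ℤ (V t → ℤ)}
    {T : Submodule ℤ ((Σ t, V t) → ℤ)} {a : ∀ t, ι t → ℕ} (hR : ∀ t, IsDiagonal (R t) (a t))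
    (hT : ∀ x, x ∈ T ↔ ∀ t, x ∘ Sigma.mk t ∈ R t) :
    IsDiagonal T (fun i : Σ t, ι t => a i.1 i.2) := by
  choose Q hQ using hR
  refine ⟨(LinearEquiv.piCurry ℤ (fun (t : τ) (_ : V t) => ℤ)).trans
    ((LinearEquiv.piCongrRight Q).trans
      (LinearEquiv.piCurry ℤ (fun (t : τ) (_ : ι t) => ℤ)).symm), fun x => ?_⟩
  rw [hT, Sigma.forall]
  exact forall_congr' fun t => hQ t _

/-! ### Row lattices of RA matrices -/

theorem mem_closedNbhd {V : Type} {Γ : SimpleGraph V} {v w : V} :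
    w ∈ closedNbhd Γ v ↔ w = v ∨ Γ.Adj v w := Iff.rfl

open Classical in
theorem bitVector_apply {V : Type} (S : Set V) (v : V) :
    bitVector S v = if v ∈ S then 1 else 0 := by
  simp [bitVector, Set.indicator_apply]

theorem bitVector_empty {V : Type} : bitVector (∅ : Set V) = 0 := Set.indicator_empty _

theorem bitVector_univ {V : Type} : bitVector (Set.univ : Set V) = 1 := Set.indicator_univ _

theorem bitVector_comp {V W : Type} (S : Set W) (f : V → W) :
    bitVector S ∘ f = bitVector (f ⁻¹' S) := by
  classical
  ext v
  rw [Function.comp_apply, bitVector_apply, bitVector_apply]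
  exact if_congr Iff.rfl rfl rfl

theorem extendByZero_bitVector {V W : Type} {f : V → W} (hf : Function.Injective f) (S : Set V) :
    Function.ExtendByZero.linearMap ℤ f (bitVector S) = bitVector (f '' S) := by
  classical
  ext w
  change Function.extend f (bitVector S) 0 w = _
  by_cases hw : ∃ v, f v = w
  · obtain ⟨v, rfl⟩ := hw
    rw [hf.extend_apply, bitVector_apply, bitVector_apply, hf.mem_set_image]
  · rw [Function.extend_apply' _ _ _ hw, bitVector_apply, if_neg]
    · rfl
    · rintro ⟨v, _, hv⟩
      exact hw ⟨v, hv⟩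

/-- The lattice spanned by the rows of the RA matrix. -/
noncomputable def rowLattice {V : Type} (Γ : SimpleGraph V) : Submodule ℤ (V → ℤ) :=
  rowSpan (raMatrix Γ)

theorem bitVector_inter_mem_rowLattice {V : Type} (Γ : SimpleGraph V) (u v : V) :
    bitVector (closedNbhd Γ u ∩ closedNbhd Γ v) ∈ rowLattice Γ :=
  Submodule.subset_span ⟨Sum.inr (u, v), rfl⟩

theorem bitVector_closedNbhd_mem_rowLattice {V : Type} (Γ : SimpleGraph V) (v : V) :
    bitVector (closedNbhd Γ v) ∈ rowLattice Γ :=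
  Submodule.subset_span ⟨Sum.inl v, rfl⟩

/-- Pairs suffice as generators, since `N[v] = N[v] ∩ N[v]`. -/
theorem rowLattice_le {V : Type} {Γ : SimpleGraph V} {M : Submodule ℤ (V → ℤ)}
    (h : ∀ u v, bitVector (closedNbhd Γ u ∩ closedNbhd Γ v) ∈ M) : rowLattice Γ ≤ M := by
  refine Submodule.span_le.2 ?_
  rintro _ ⟨v | ⟨u, v⟩, rfl⟩
  · have := h v v
    rw [Set.inter_self] at this
    exact this
  · exact h u v

/-- Pullback along `f` is linear and takes bit vectors to bit vectors of preimages, so generators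
suffice. -/
theorem comp_mem_of_mem_rowLattice {V W : Type} {Γ : SimpleGraph W} {M : Submodule ℤ (V → ℤ)}
    (f : V → W) (h : ∀ u v, bitVector (f ⁻¹' (closedNbhd Γ u ∩ closedNbhd Γ v)) ∈ M)
    {x : W → ℤ} (hx : x ∈ rowLattice Γ) : x ∘ f ∈ M := by
  have : rowLattice Γ ≤ M.comap (LinearMap.funLeft ℤ ℤ f) := rowLattice_le fun u v => by
    rw [Submodule.mem_comap]
    change bitVector _ ∘ f ∈ M
    rw [bitVector_comp]
    exact h u v
  exact this hx

theorem extend_mem_of_mem_rowLattice {V W : Type} {Γ : SimpleGraph V} {M : Submodule ℤ (W → ℤ)}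
    {f : V → W} (hf : Function.Injective f)
    (h : ∀ u v, bitVector (f '' (closedNbhd Γ u ∩ closedNbhd Γ v)) ∈ M)
    {x : V → ℤ} (hx : x ∈ rowLattice Γ) : Function.ExtendByZero.linearMap ℤ f x ∈ M := by
  have : rowLattice Γ ≤ M.comap (Function.ExtendByZero.linearMap ℤ f) :=
    rowLattice_le fun u v => by
      rw [Submodule.mem_comap, extendByZero_bitVector hf]
      exact h u v
  exact this hx

theorem extendByZero_apply_self {V W : Type} {f : V → W} (hf : Function.Injective f)
    (x : V → ℤ) (v : V) : Function.ExtendByZero.linearMap ℤ f x (f v) = x v :=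
  hf.extend_apply x 0 v

theorem extendByZero_apply_of_notMem {V W : Type} {f : V → W} (x : V → ℤ) {w : W}
    (hw : ¬ ∃ v, f v = w) : Function.ExtendByZero.linearMap ℤ f x w = 0 :=
  Function.extend_apply' (f := f) x (0 : W → ℤ) w hw

theorem eq_extendByZero_inl_add_inr {V W : Type} (x : V ⊕ W → ℤ) :
    x = Function.ExtendByZero.linearMap ℤ Sum.inl (x ∘ Sum.inl) +
      Function.ExtendByZero.linearMap ℤ Sum.inr (x ∘ Sum.inr) := by
  ext (v | w)
  · rw [Pi.add_apply, extendByZero_apply_self Sum.inl_injective,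
      extendByZero_apply_of_notMem _ (by simp), add_zero]
    rfl
  · rw [Pi.add_apply, extendByZero_apply_self Sum.inr_injective,
      extendByZero_apply_of_notMem _ (by simp), zero_add]
    rfl

/-! ### Disjoint unions and pyramids -/

theorem closedNbhd_sum_inl {V W : Type} (G : SimpleGraph V) (H : SimpleGraph W) (v : V) :
    closedNbhd (G ⊕g H) (Sum.inl v) = Sum.inl '' closedNbhd G v := by
  ext (w | w) <;> simp [mem_closedNbhd]

theorem closedNbhd_sum_inr {V W : Type} (G : SimpleGraph V) (H : SimpleGraph W) (w : W) :
    closedNbhd (G ⊕g H) (Sum.inr w) = Sum.inr '' closedNbhd H w := by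
  ext (w | w) <;> simp [mem_closedNbhd]

theorem mem_rowLattice_sum {V W : Type} (G : SimpleGraph V) (H : SimpleGraph W)
    (x : V ⊕ W → ℤ) :
    x ∈ rowLattice (G ⊕g H) ↔ x ∘ Sum.inl ∈ rowLattice G ∧ x ∘ Sum.inr ∈ rowLattice H := by
  constructor
  · intro hx
    constructor
    · refine comp_mem_of_mem_rowLattice _ ?_ hx
      rintro (u | u) (v | v) <;>
        simp only [closedNbhd_sum_inl, closedNbhd_sum_inr, Set.preimage_inter,
          Set.preimage_image_eq _ Sum.inl_injective, Set.preimage_inl_image_inr,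
          Set.empty_inter, Set.inter_empty, bitVector_empty]
      · exact bitVector_inter_mem_rowLattice G u v
      all_goals exact Submodule.zero_mem _
    · refine comp_mem_of_mem_rowLattice _ ?_ hx
      rintro (u | u) (v | v) <;>
        simp only [closedNbhd_sum_inl, closedNbhd_sum_inr, Set.preimage_inter,
          Set.preimage_image_eq _ Sum.inr_injective, Set.preimage_inr_image_inl,
          Set.empty_inter, Set.inter_empty, bitVector_empty]
      · exact Submodule.zero_mem _
      · exact Submodule.zero_mem _
      · exact Submodule.zero_mem _
      · exact bitVector_inter_mem_rowLattice H u v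
  · rintro ⟨hG, hH⟩
    rw [eq_extendByZero_inl_add_inr x]
    refine Submodule.add_mem _ (extend_mem_of_mem_rowLattice Sum.inl_injective ?_ hG)
      (extend_mem_of_mem_rowLattice Sum.inr_injective ?_ hH)
    · intro u v
      rw [Set.image_inter Sum.inl_injective, ← closedNbhd_sum_inl G H, ← closedNbhd_sum_inl G H]
      exact bitVector_inter_mem_rowLattice _ _ _
    · intro u v
      rw [Set.image_inter Sum.inr_injective, ← closedNbhd_sum_inr G H, ← closedNbhd_sum_inr G H]
      exact bitVector_inter_mem_rowLattice _ _ _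

theorem closedNbhd_disjointUnion {τ : Type} {V : τ → Type} (G : ∀ t, SimpleGraph (V t)) (t : τ)
    (v : V t) : closedNbhd (disjointUnion G) ⟨t, v⟩ = Sigma.mk t '' closedNbhd (G t) v := by
  ext w
  rw [mem_closedNbhd]
  constructor
  · rintro (rfl | ⟨i, a, b, h, rfl, hab⟩)
    · exact ⟨v, Or.inl rfl, rfl⟩
    · cases h
      exact ⟨b, Or.inr hab, rfl⟩
  · rintro ⟨w, rfl | hw, rfl⟩
    · exact Or.inl rfl
    · exact Or.inr ⟨t, v, w, rfl, rfl, hw⟩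

theorem mem_rowLattice_disjointUnion {τ : Type} [Finite τ] {V : τ → Type}
    (G : ∀ t, SimpleGraph (V t)) (x : (Σ t, V t) → ℤ) :
    x ∈ rowLattice (disjointUnion G) ↔ ∀ t, x ∘ Sigma.mk t ∈ rowLattice (G t) := by
  classical
  constructor
  · intro hx t
    refine comp_mem_of_mem_rowLattice _ ?_ hx
    rintro ⟨i, u⟩ ⟨j, v⟩
    rw [closedNbhd_disjointUnion, closedNbhd_disjointUnion, Set.preimage_inter]
    by_cases hi : i = t
    · by_cases hj : j = t
      · subst hi hj
        rw [Set.preimage_image_eq _ sigma_mk_injective, Set.preimage_image_eq _ sigma_mk_injective]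
        exact bitVector_inter_mem_rowLattice _ _ _
      · rw [Set.preimage_image_sigmaMk_of_ne (Ne.symm hj), Set.inter_empty, bitVector_empty]
        exact Submodule.zero_mem _
    · rw [Set.preimage_image_sigmaMk_of_ne (Ne.symm hi), Set.empty_inter, bitVector_empty]
      exact Submodule.zero_mem _
  · intro h
    have := Fintype.ofFinite τ
    have hx : x = ∑ t, Function.ExtendByZero.linearMap ℤ (Sigma.mk t) (x ∘ Sigma.mk t) := by
      ext ⟨t, v⟩
      rw [Finset.sum_apply, Finset.sum_eq_single t]
      · rw [extendByZero_apply_self sigma_mk_injective]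
        rfl
      · intro s _ hs
        refine extendByZero_apply_of_notMem _ ?_
        rintro ⟨w, hw⟩
        exact hs (congrArg Sigma.fst hw)
      · simp
    rw [hx]
    refine Submodule.sum_mem _ fun t _ =>
      extend_mem_of_mem_rowLattice sigma_mk_injective (fun u v => ?_) (h t)
    rw [Set.image_inter sigma_mk_injective, ← closedNbhd_disjointUnion,
      ← closedNbhd_disjointUnion]
    exact bitVector_inter_mem_rowLattice _ _ _

theorem closedNbhd_pyramid_inl {V : Type} (G : SimpleGraph V) (t : Unit) :
    closedNbhd (pyramid G) (Sum.inl t) = Set.univ := by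
  ext (w | w)
  · simp [mem_closedNbhd]
  · simp [mem_closedNbhd, pyramid, join]

theorem closedNbhd_pyramid_inr {V : Type} (G : SimpleGraph V) (v : V) :
    closedNbhd (pyramid G) (Sum.inr v) = insert (Sum.inl ()) (Sum.inr '' closedNbhd G v) := by
  ext (w | w) <;> simp [mem_closedNbhd, pyramid, join]

/-- Each intersection of closed neighborhoods of base vertices gains the apex. For `a` and `b` it
becomes the apex alone, whose unit vector can then be subtracted from all other rows. The apex's own
neighborhood restricts to the all-ones vector, which is why `h1` is needed. -/
theorem mem_rowLattice_pyramid {V : Type} (G : SimpleGraph V) (h1 : 1 ∈ rowLattice G) {a b : V}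
    (hab : closedNbhd G a ∩ closedNbhd G b = ∅) (x : Unit ⊕ V → ℤ) :
    x ∈ rowLattice (pyramid G) ↔ x ∘ Sum.inr ∈ rowLattice G := by
  classical
  have hpre : ∀ v, Sum.inr ⁻¹' closedNbhd (pyramid G) (Sum.inr v) = closedNbhd G v := by
    intro v
    rw [closedNbhd_pyramid_inr]
    ext w
    simp
  have hinter : ∀ u v, closedNbhd (pyramid G) (Sum.inr u) ∩ closedNbhd (pyramid G) (Sum.inr v) =
      insert (Sum.inl ()) (Sum.inr '' (closedNbhd G u ∩ closedNbhd G v)) := by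
    intro u v
    rw [closedNbhd_pyramid_inr, closedNbhd_pyramid_inr, Set.image_inter Sum.inr_injective,
      Set.insert_inter_distrib]
  have hinsert : ∀ S : Set V, bitVector (insert (Sum.inl ()) (Sum.inr '' S)) =
      bitVector {(Sum.inl () : Unit ⊕ V)} + bitVector (Sum.inr '' S) := by
    intro S
    ext (w | w) <;> simp [bitVector_apply]
  have happ : bitVector {(Sum.inl () : Unit ⊕ V)} ∈ rowLattice (pyramid G) := by
    have := bitVector_inter_mem_rowLattice (pyramid G) (Sum.inr a) (Sum.inr b)
    rw [hinter, hab, Set.image_empty] at this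
    simpa using this
  constructor
  · refine comp_mem_of_mem_rowLattice _ ?_
    rintro (u | u) (v | v) <;>
      simp only [closedNbhd_pyramid_inl, Set.preimage_inter, hpre, Set.preimage_univ,
        Set.univ_inter, Set.inter_univ, bitVector_univ]
    · exact h1
    · exact bitVector_closedNbhd_mem_rowLattice G v
    · exact bitVector_closedNbhd_mem_rowLattice G u
    · exact bitVector_inter_mem_rowLattice G u v
  · intro hx
    rw [eq_extendByZero_inl_add_inr x]
    refine Submodule.add_mem _ ?_ (extend_mem_of_mem_rowLattice Sum.inr_injective ?_ hx)
    · have : Function.ExtendByZero.linearMap ℤ Sum.inl (x ∘ Sum.inl) =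
          x (Sum.inl ()) • bitVector {(Sum.inl () : Unit ⊕ V)} := by
        ext (w | w)
        · rw [extendByZero_apply_self Sum.inl_injective]
          simp [bitVector_apply]
        · rw [extendByZero_apply_of_notMem _ (by simp)]
          simp [bitVector_apply]
      rw [this]
      exact Submodule.smul_mem _ _ happ
    · intro u v
      have := Submodule.sub_mem _
        (bitVector_inter_mem_rowLattice (pyramid G) (Sum.inr u) (Sum.inr v)) happ
      rwa [hinter, hinsert, add_sub_cancel_left] at this

theorem pyramid_connected {V : Type} (G : SimpleGraph V) : (pyramid G).Connected := by
  have h : ∀ x, (pyramid G).Reachable (Sum.inl ()) x := by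
    rintro (x | x)
    · exact SimpleGraph.Reachable.refl _
    · exact SimpleGraph.Adj.reachable (by simp [pyramid, join])
  exact SimpleGraph.Connected.mk (fun x y => (h x).symm.trans (h y)) (nonempty := ⟨Sum.inl ()⟩)

/-! ### Crown graphs -/

/-- As `φ` is `1` on the unit vector at `v₀`, the coordinate at `v₀` can be replaced by `φ`. This
change of coordinates is `1 + ψ` with `ψ² = 0`, so its inverse is `1 - ψ`. -/
theorem isDiagonal_of_mem_iff_dvd {V : Type} [DecidableEq V] {R : Submodule ℤ (V → ℤ)}
    (φ : (V → ℤ) →ₗ[ℤ] ℤ) {d : ℕ} {v₀ : V} (hv : φ (Pi.single v₀ 1) = 1)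
    (hR : ∀ x, x ∈ R ↔ (d : ℤ) ∣ φ x) : IsDiagonal R (fun v => if v = v₀ then d else 1) := by
  let ψ : (V → ℤ) →ₗ[ℤ] (V → ℤ) :=
    (φ - LinearMap.proj v₀).smulRight (Pi.single v₀ (1 : ℤ))
  have hψ : ∀ x, ψ x = (φ x - x v₀) • Pi.single v₀ (1 : ℤ) := fun x => rfl
  have hψψ : ∀ x, ψ (ψ x) = 0 := by
    intro x
    rw [hψ (ψ x), hψ x, map_smul, hv]
    simp
  refine ⟨LinearEquiv.ofLinearMap (LinearMap.id + ψ) (LinearMap.id - ψ) ?_ ?_, fun x => ?_⟩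
  · refine LinearMap.ext fun x => ?_
    simp [hψψ]
  · refine LinearMap.ext fun x => ?_
    simp [hψψ]
  · have hQ : ∀ v, (x + ψ x) v = if v = v₀ then φ x else x v := by
      intro v
      rw [hψ]
      by_cases h : v = v₀
      · subst h; simp
      · simp [h]
    rw [hR]
    change _ ↔ ∀ v, _ ∣ (x + ψ x) v
    simp only [hQ]
    constructor
    · intro h v
      by_cases hv : v = v₀ <;> simp [hv, h]
    · intro h
      simpa using h v₀

theorem mem_closedNbhd_crownGraph {m : ℕ} {i j : Fin m} :
    (Sum.inl j ∈ closedNbhd (crownGraph m) (Sum.inl i) ↔ j = i) ∧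
    (Sum.inr j ∈ closedNbhd (crownGraph m) (Sum.inl i) ↔ j ≠ i) ∧
    (Sum.inl j ∈ closedNbhd (crownGraph m) (Sum.inr i) ↔ j ≠ i) ∧
    (Sum.inr j ∈ closedNbhd (crownGraph m) (Sum.inr i) ↔ j = i) := by
  simp [mem_closedNbhd, crownGraph, eq_comm]

/-- The sum of the unprimed coordinates minus the sum of the primed ones. -/
def sideDiff (m : ℕ) : (Fin m ⊕ Fin m → ℤ) →ₗ[ℤ] ℤ :=
  ∑ i : Fin m, (LinearMap.proj (R := ℤ) (φ := fun _ => ℤ) (Sum.inl i) -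
    LinearMap.proj (R := ℤ) (φ := fun _ => ℤ) (Sum.inr i))

theorem sideDiff_apply {m : ℕ} (x : Fin m ⊕ Fin m → ℤ) :
    sideDiff m x = ∑ i, (x (Sum.inl i) - x (Sum.inr i)) := by
  simp [sideDiff]

/-- For two vertices on the same side, index `k` contributes `±([k = i] + [k = j] - 1)`, with total
`±(2 - (d + 2))`; this is the origin of the shift by `2`. For opposite sides it contributes `±([k =
i] - [k = j])`, with total `0`. -/
theorem dvd_sideDiff_bitVector {d : ℕ} (u v : Fin (d + 2) ⊕ Fin (d + 2)) :
    (d : ℤ) ∣ sideDiff (d + 2) (bitVector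
      (closedNbhd (crownGraph (d + 2)) u ∩ closedNbhd (crownGraph (d + 2)) v)) := by
  classical
  have hsame : ∀ i j : Fin (d + 2),
      ∑ k, (((if k = i then 1 else 0) : ℤ) + (if k = j then 1 else 0) - 1) = -d := by
    intro i j
    rw [Finset.sum_sub_distrib, Finset.sum_add_distrib]
    simp
  have hdiff : ∀ i j : Fin (d + 2),
      ∑ k, (((if k = i then 1 else 0) : ℤ) - (if k = j then 1 else 0)) = 0 := by
    intro i j
    rw [Finset.sum_sub_distrib]
    simp
  rw [sideDiff_apply]
  rcases u with i | i <;> rcases v with j | j <;>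
    simp only [bitVector_apply, Set.mem_inter_iff, mem_closedNbhd_crownGraph]
  · rw [Finset.sum_congr rfl (g := fun k =>
      (((if k = i then 1 else 0) : ℤ) + (if k = j then 1 else 0) - 1)) fun k _ => by
        grind, hsame]
    simp
  · rw [Finset.sum_congr rfl (g := fun k =>
      (((if k = i then 1 else 0) : ℤ) - (if k = j then 1 else 0))) fun k _ => by
        grind, hdiff]
    simp
  · rw [Finset.sum_congr rfl (g := fun k =>
      (((if k = j then 1 else 0) : ℤ) - (if k = i then 1 else 0))) fun k _ => by
        grind, hdiff]
    simp
  · rw [Finset.sum_congr rfl (g := fun k =>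
      -(((if k = i then 1 else 0) : ℤ) + (if k = j then 1 else 0) - 1)) fun k _ => by
        grind,
      Finset.sum_neg_distrib, hsame]
    simp

theorem mem_rowLattice_crownGraph {d : ℕ} (hd : 1 ≤ d) (x : Fin (d + 2) ⊕ Fin (d + 2) → ℤ) :
    x ∈ rowLattice (crownGraph (d + 2)) ↔ (d : ℤ) ∣ sideDiff (d + 2) x := by
  classical
  constructor
  · intro hx
    have : rowLattice (crownGraph (d + 2)) ≤
        Submodule.comap (sideDiff (d + 2)) (Ideal.span {(d : ℤ)}) := by
      refine rowLattice_le fun u v => ?_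
      rw [Submodule.mem_comap]
      exact Ideal.mem_span_singleton.2 (dvd_sideDiff_bitVector u v)
    exact Ideal.mem_span_singleton.1 (this hx)
  · intro hx
    let p : Fin (d + 2) → Fin (d + 2) ⊕ Fin (d + 2) → ℤ := fun i => Pi.single (Sum.inl i) 1
    let q : Fin (d + 2) → Fin (d + 2) ⊕ Fin (d + 2) → ℤ := fun i => Pi.single (Sum.inr i) 1
    -- For `i ≠ j` the intersection of `N[i]` and `N[j']` is exactly `{i, j'}`.
    have hne : ∀ i j, i ≠ j → p i + q j ∈ rowLattice (crownGraph (d + 2)) := by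
      intro i j hij
      have := bitVector_inter_mem_rowLattice (crownGraph (d + 2)) (Sum.inl i) (Sum.inr j)
      convert this using 1
      ext (k | k)
      · by_cases hk : k = i
        · simp [p, q, bitVector_apply, mem_closedNbhd_crownGraph, hk, hij]
        · simp [p, q, bitVector_apply, mem_closedNbhd_crownGraph, hk]
      · by_cases hk : k = j
        · simp [p, q, bitVector_apply, mem_closedNbhd_crownGraph, hk, hij.symm]
        · simp [p, q, bitVector_apply, mem_closedNbhd_crownGraph, hk]
    -- For distinct `i, j, k`, available because `d + 2 ≥ 3`, one has `p i + q i = (p i + q j) + (p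
    -- k + q i) - (p k + q j)`.
    have hpq : ∀ i j, p i + q j ∈ rowLattice (crownGraph (d + 2)) := by
      intro i j
      by_cases hij : i = j
      · subst hij
        obtain ⟨j, hj⟩ : ∃ j, j ∉ ({i} : Finset (Fin (d + 2))) := by
          by_contra! h
          have := Finset.card_le_card (fun j _ => h j : Finset.univ ⊆ ({i} : Finset _))
          simp at this
        obtain ⟨k, hk⟩ : ∃ k, k ∉ ({i, j} : Finset (Fin (d + 2))) := by
          by_contra! h
          have := Finset.card_le_card (fun j _ => h j : Finset.univ ⊆ ({i, j} : Finset _))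
          have := this.trans Finset.card_le_two
          simp at this
          omega
        simp only [Finset.mem_singleton, Finset.mem_insert, not_or] at hj hk
        have := Submodule.sub_mem _ (Submodule.add_mem _ (hne i j (Ne.symm hj)) (hne k i hk.1))
          (hne k j hk.2)
        convert this using 1
        abel
      · exact hne i j hij
    -- The sum of `p 0 + q j` over the `d + 1` indices `j ≠ 0` contains `p 0` with multiplicity `d +
    -- 1`; subtracting the row of `N[0]` removes all `q j` and one `p 0`.
    have hd0 : (d : ℤ) • p 0 ∈ rowLattice (crownGraph (d + 2)) := by
      have h1 := bitVector_closedNbhd_mem_rowLattice (crownGraph (d + 2)) (Sum.inl 0)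
      have h2 : ∑ j : Fin (d + 1), (p 0 + q j.succ) ∈ rowLattice (crownGraph (d + 2)) :=
        Submodule.sum_mem _ fun j _ => hpq _ _
      have h3 : bitVector (closedNbhd (crownGraph (d + 2)) (Sum.inl 0)) =
          p 0 + ∑ j : Fin (d + 1), q j.succ := by
        ext (k | k)
        · simp [p, q, bitVector_apply, mem_closedNbhd_crownGraph, Pi.single_apply]
        · refine Fin.cases ?_ (fun k => ?_) k
          · simp [p, q, bitVector_apply, mem_closedNbhd_crownGraph,
              (Fin.succ_ne_zero _).symm]
          · simp [p, q, bitVector_apply, mem_closedNbhd_crownGraph, Pi.single_apply]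
      have := Submodule.sub_mem _ h2 h1
      convert this using 1
      rw [h3, Finset.sum_add_distrib, Finset.sum_const, Finset.card_univ, Fintype.card_fin]
      rw [add_sub_add_right_eq_sub, ← natCast_zsmul, Nat.cast_add, add_smul]
      simp
    obtain ⟨c, hc⟩ := hx
    -- Modulo the vectors `p i + q j`, every `p i` equals `p 0` and every `q j` equals `-p 0`, so
    -- `x` is congruent to `sideDiff x` times `p 0`.
    have hx : x = ∑ i, x (Sum.inl i) • (p i + q 0) + ∑ i, x (Sum.inr i) • (p 0 + q i)
        - (∑ i, x (Sum.inl i)) • (p 0 + q 0) + sideDiff (d + 2) x • p 0 := by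
      have hx1 : x = ∑ i, x (Sum.inl i) • p i + ∑ i, x (Sum.inr i) • q i := by
        ext (k | k) <;> simp [p, q, Pi.single_apply]
      rw [sideDiff_apply, Finset.sum_sub_distrib]
      simp only [smul_add, Finset.sum_add_distrib, sub_smul, ← Finset.sum_smul]
      nth_rewrite 1 [hx1]
      abel
    rw [hx]
    refine Submodule.add_mem _ (Submodule.sub_mem _ (Submodule.add_mem _ ?_ ?_) ?_) ?_
    · exact Submodule.sum_mem _ fun i _ => Submodule.smul_mem _ _ (hpq _ _)
    · exact Submodule.sum_mem _ fun i _ => Submodule.smul_mem _ _ (hpq _ _)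
    · exact Submodule.smul_mem _ _ (hpq _ _)
    · rw [hc, mul_comm, mul_smul]
      exact Submodule.smul_mem _ _ hd0

theorem isDiagonal_rowLattice_crownGraph {d : ℕ} (hd : 1 ≤ d) :
    IsDiagonal (rowLattice (crownGraph (d + 2)))
      (fun v : Fin (d + 2) ⊕ Fin (d + 2) => if v = Sum.inl 0 then d else 1) := by
  refine isDiagonal_of_mem_iff_dvd (sideDiff (d + 2)) ?_ (mem_rowLattice_crownGraph hd)
  rw [sideDiff_apply]
  simp [Pi.single_apply]

theorem one_mem_rowLattice_crownGraph {d : ℕ} (hd : 1 ≤ d) :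
    1 ∈ rowLattice (crownGraph (d + 2)) := by
  rw [mem_rowLattice_crownGraph hd, sideDiff_apply]
  simp

theorem closedNbhd_inl_inter_inr_crownGraph {m : ℕ} (i : Fin m) :
    closedNbhd (crownGraph m) (Sum.inl i) ∩ closedNbhd (crownGraph m) (Sum.inr i) = ∅ := by
  ext (j | j) <;> simp [mem_closedNbhd_crownGraph]

/-! ### Binary graphs -/

/-- The indicator vector of the numbers below `N` whose binary expansion contains that of `s`. -/
def supermaskVector (N s : ℕ) : Fin N → ℤ := fun t => if s &&& (t : ℕ) = s then 1 else 0

/-- The number `s` has at most two ones in its binary expansion. -/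
def AtMostTwoBits (s : ℕ) : Prop := s = 0 ∨ ∃ b c : ℕ, s = 2 ^ b ||| 2 ^ c

theorem two_pow_or_two_pow_and_eq_iff (b c t : ℕ) :
    (2 ^ b ||| 2 ^ c) &&& t = 2 ^ b ||| 2 ^ c ↔ t.testBit b = true ∧ t.testBit c = true := by
  constructor
  · intro h
    have hb := congrArg (fun n => n.testBit b) h
    have hc := congrArg (fun n => n.testBit c) h
    simp only [Nat.testBit_and, Nat.testBit_or, Nat.testBit_two_pow] at hb hc
    simpa using And.intro hb hc
  · rintro ⟨hb, hc⟩
    refine Nat.eq_of_testBit_eq fun i => ?_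
    rw [Nat.testBit_and, Nat.testBit_or, Nat.testBit_two_pow, Nat.testBit_two_pow]
    by_cases h1 : b = i
    · subst h1; simp [hb]
    · by_cases h2 : c = i
      · subst h2; simp [hc]
      · simp [h1, h2]

theorem supermaskVector_zero (N : ℕ) : supermaskVector N 0 = 1 := by
  ext t
  simp [supermaskVector]

theorem supermaskVector_two_pow (N b c : ℕ) (t : Fin N) :
    supermaskVector N (2 ^ b ||| 2 ^ c) t =
      if (t : ℕ).testBit b = true ∧ (t : ℕ).testBit c = true then 1 else 0 := by
  simp only [supermaskVector, two_pow_or_two_pow_and_eq_iff]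

/-- A mask contained in `t` is at most `t`. Hence the masks from `N` on add nothing to `maskLattice
N`. -/
theorem supermaskVector_of_le {N s : ℕ} (h : N ≤ s) : supermaskVector N s = 0 := by
  ext t
  have : s &&& (t : ℕ) ≤ t := Nat.and_le_right
  have : s &&& (t : ℕ) ≠ s := by omega
  simp [supermaskVector, this]

/-- The lattice spanned by the `supermaskVector`s of the numbers with at most two ones. -/
def maskLattice (N : ℕ) : Submodule ℤ (Fin N → ℤ) :=
  Submodule.span ℤ (supermaskVector N '' Set.ofPred AtMostTwoBits)

-- Since `s &&& t = s` forces `s ≤ t`, the matrix of all mask vectors with `s < N` is triangular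
-- with ones on the diagonal. These vectors form a basis of `ℤ^N`, and the lattice is spanned by a
-- subset of it.
open Classical in
theorem isDiagonal_maskLattice (N : ℕ) :
    IsDiagonal (maskLattice N) (fun k : Fin N => if AtMostTwoBits k then 1 else 0) := by
  let M : Matrix (Fin N) (Fin N) ℤ := Matrix.of fun t s => supermaskVector N s t
  have hM : IsUnit M.det := by
    rw [Matrix.det_of_isLowerTriangular]
    · simp [M, supermaskVector]
    · intro t s hts
      have hts : t < s := hts
      have : (s : ℕ) &&& (t : ℕ) ≤ t := Nat.and_le_right
      have : (s : ℕ) &&& (t : ℕ) ≠ s := by omega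
      simp [M, supermaskVector, this]
  let F := Matrix.toLinearEquiv (Pi.basisFun ℤ (Fin N)) M hM
  have hF : ∀ c : Fin N → ℤ, F c = ∑ s, c s • supermaskVector N s := by
    intro c
    change Matrix.toLin (Pi.basisFun ℤ (Fin N)) (Pi.basisFun ℤ (Fin N)) M c = _
    ext t
    simp [M, Matrix.toLin_eq_toLin', Matrix.mulVec, dotProduct, mul_comm]
  refine ⟨F.symm, fun x => ?_⟩
  constructor
  · intro hx
    induction hx using Submodule.span_induction with
    | mem x hx =>
      obtain ⟨s, hs, rfl⟩ := hx
      by_cases hsN : s < N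
      · have : F (Pi.single ⟨s, hsN⟩ 1) = supermaskVector N s := by
          rw [hF, Finset.sum_eq_single ⟨s, hsN⟩] <;> simp +contextual
        rw [← this, LinearEquiv.symm_apply_apply]
        intro i
        by_cases hi : i = ⟨s, hsN⟩
        · subst hi
          have : AtMostTwoBits s := hs
          simp [this]
        · simp [hi]
      · simp [supermaskVector_of_le (not_lt.1 hsN)]
    | zero => simp
    | add x y _ _ hx hy => intro i; rw [map_add]; exact dvd_add (hx i) (hy i)
    | smul c x _ hx => intro i; rw [map_smul]; exact Dvd.dvd.mul_left (hx i) c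
  · intro h
    rw [← F.apply_symm_apply x, hF]
    refine Submodule.sum_mem _ fun s _ => ?_
    have := h s
    by_cases hs : AtMostTwoBits s
    · exact Submodule.smul_mem _ _ (Submodule.subset_span ⟨s, hs, rfl⟩)
    · simp [hs] at this
      simp [this]

@[simp]
theorem inl_mem_closedNbhd_inl_binaryGraph {N : ℕ} (k l : Fin N) :
    Sum.inl l ∈ closedNbhd (binaryGraph N) (Sum.inl k) := by
  by_cases h : l = k
  · exact Or.inl (congrArg _ h)
  · exact Or.inr (Ne.symm h)

@[simp]
theorem inr_mem_closedNbhd_inr_binaryGraph {N : ℕ} (i j : Fin (Nat.clog 2 N)) :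
    Sum.inr j ∈ closedNbhd (binaryGraph N) (Sum.inr i) := by
  by_cases h : j = i
  · exact Or.inl (congrArg _ h)
  · exact Or.inr (Ne.symm h)

theorem mem_closedNbhd_binaryGraph {N : ℕ} {k : Fin N} {i : Fin (Nat.clog 2 N)} :
    (Sum.inr i ∈ closedNbhd (binaryGraph N) (Sum.inl k) ↔ (k : ℕ).testBit i = true) ∧
    (Sum.inl k ∈ closedNbhd (binaryGraph N) (Sum.inr i) ↔ (k : ℕ).testBit i = true) := by
  simp [mem_closedNbhd, binaryGraph]

/-- On the numbers, the neighborhood intersections restrict to mask vectors with zero, one or two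
bits, or to masks already of this kind when a number is involved. Conversely, the unit vectors of
the bit positions lie in the lattice, so the entries there can be corrected freely. -/
theorem mem_rowLattice_binaryGraph {N : ℕ} (hN : 2 ≤ N)
    (x : Fin N ⊕ Fin (Nat.clog 2 N) → ℤ) :
    x ∈ rowLattice (binaryGraph N) ↔ x ∘ Sum.inl ∈ maskLattice N := by
  classical
  have hN' : N ≤ 2 ^ Nat.clog 2 N := Nat.le_pow_clog one_lt_two N
  constructor
  · refine comp_mem_of_mem_rowLattice _ ?_
    have h0 : (1 : Fin N → ℤ) ∈ maskLattice N :=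
      Submodule.subset_span ⟨0, Or.inl rfl, supermaskVector_zero N⟩
    have h2 : ∀ b c : ℕ, supermaskVector N (2 ^ b ||| 2 ^ c) ∈ maskLattice N :=
      fun b c => Submodule.subset_span ⟨_, Or.inr ⟨b, c, rfl⟩, rfl⟩
    rintro (k | i) (l | j)
    · convert h0 using 1
      ext t
      simp [bitVector_apply]
    -- A single bit is the case `b = c` of a two-bit mask.
    · convert h2 j j using 1
      ext t
      simp [bitVector_apply, mem_closedNbhd_binaryGraph, supermaskVector_two_pow,
        -Nat.or_self]
    · convert h2 i i using 1
      ext t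
      simp [bitVector_apply, mem_closedNbhd_binaryGraph, supermaskVector_two_pow,
        -Nat.or_self]
    · convert h2 i j using 1
      ext t
      simp [bitVector_apply, mem_closedNbhd_binaryGraph, supermaskVector_two_pow]
  · intro hx
    let Z : Fin N := ⟨0, by omega⟩
    -- The number `0` has no bits, so its closed neighborhood is the set of all numbers.
    have hZ : bitVector (closedNbhd (binaryGraph N) (Sum.inl Z)) =
        Function.ExtendByZero.linearMap ℤ Sum.inl 1 := by
      ext (t | j)
      · rw [extendByZero_apply_self Sum.inl_injective]
        simp [bitVector_apply]
      · rw [extendByZero_apply_of_notMem _ (by simp)]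
        simp [bitVector_apply, mem_closedNbhd_binaryGraph, Z]
    have hZmem := bitVector_closedNbhd_mem_rowLattice (binaryGraph N) (Sum.inl Z)
    have hbit : ∀ i : Fin (Nat.clog 2 N),
        (Pi.single (Sum.inr i) 1 : _ → ℤ) ∈ rowLattice (binaryGraph N) := by
      intro i
      -- Thus `2 ^ i` is itself a vertex, and its closed neighborhood exceeds that of `0` by the bit
      -- position `i` only.
      have hi : 2 ^ (i : ℕ) < N := (Nat.lt_clog_iff_pow_lt one_lt_two).1 i.2
      have := Submodule.sub_mem _ (bitVector_closedNbhd_mem_rowLattice (binaryGraph N)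
        (Sum.inl ⟨2 ^ (i : ℕ), hi⟩)) hZmem
      convert this using 1
      ext (t | j)
      · simp [bitVector_apply]
      · simp [bitVector_apply, mem_closedNbhd_binaryGraph, Z, Pi.single_apply,
          Nat.testBit_two_pow, Fin.ext_iff, eq_comm]
    have hbits : ∀ y : Fin (Nat.clog 2 N) → ℤ,
        Function.ExtendByZero.linearMap ℤ Sum.inr y ∈ rowLattice (binaryGraph N) := by
      intro y
      have : Function.ExtendByZero.linearMap ℤ Sum.inr y =
          ∑ i, y i • (Pi.single (Sum.inr i) 1 : Fin N ⊕ Fin (Nat.clog 2 N) → ℤ) := by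
        ext (t | j)
        · rw [extendByZero_apply_of_notMem _ (by simp)]
          simp [Finset.sum_apply]
        · rw [extendByZero_apply_self Sum.inr_injective]
          simp [Finset.sum_apply, Pi.single_apply]
      rw [this]
      exact Submodule.sum_mem _ fun i _ => Submodule.smul_mem _ _ (hbit i)
    rw [eq_extendByZero_inl_add_inr x]
    refine Submodule.add_mem _ ?_ (hbits _)
    have hle : maskLattice N ≤ (rowLattice (binaryGraph N)).comap
        (Function.ExtendByZero.linearMap ℤ Sum.inl) := by
      refine Submodule.span_le.2 ?_
      rintro _ ⟨s, rfl | ⟨b, c, rfl⟩, rfl⟩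
      · change _ ∈ rowLattice (binaryGraph N)
        rw [supermaskVector_zero, ← hZ]
        exact hZmem
      · change _ ∈ rowLattice (binaryGraph N)
        by_cases hbc : b < Nat.clog 2 N ∧ c < Nat.clog 2 N
        -- The intersection of the two neighborhoods contains every bit position; `hbits 1` removes
        -- them all.
        · have := Submodule.sub_mem _ (bitVector_inter_mem_rowLattice (binaryGraph N)
            (Sum.inr ⟨b, hbc.1⟩) (Sum.inr ⟨c, hbc.2⟩)) (hbits 1)
          convert this using 1
          ext (t | j)
          · rw [extendByZero_apply_self Sum.inl_injective, Pi.sub_apply,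
              extendByZero_apply_of_notMem _ (by simp)]
            simp [bitVector_apply, mem_closedNbhd_binaryGraph, supermaskVector_two_pow]
          · rw [extendByZero_apply_of_notMem _ (by simp), Pi.sub_apply,
              extendByZero_apply_self Sum.inr_injective]
            simp [bitVector_apply]
        · have : N ≤ 2 ^ b ||| 2 ^ c := by
            rcases not_and_or.1 hbc with h | h
            · exact (hN'.trans (Nat.pow_le_pow_right two_pos (not_lt.1 h))).trans Nat.left_le_or
            · exact (hN'.trans (Nat.pow_le_pow_right two_pos (not_lt.1 h))).trans Nat.right_le_or
          rw [supermaskVector_of_le this, map_zero]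
          exact Submodule.zero_mem _
    exact hle hx

open Classical in
theorem isDiagonal_rowLattice_binaryGraph {N : ℕ} (hN : 2 ≤ N) :
    IsDiagonal (rowLattice (binaryGraph N))
      (Sum.elim (fun k : Fin N => if AtMostTwoBits k then 1 else 0)
        (fun _ : Fin (Nat.clog 2 N) => 1)) :=
  (isDiagonal_maskLattice N).sum isDiagonal_top fun x => by
    simp [mem_rowLattice_binaryGraph hN]

theorem one_mem_rowLattice_binaryGraph {N : ℕ} (hN : 2 ≤ N) :
    1 ∈ rowLattice (binaryGraph N) := by
  rw [mem_rowLattice_binaryGraph hN]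
  exact Submodule.subset_span ⟨0, Or.inl rfl, supermaskVector_zero N⟩

theorem binaryGraph_connected {N : ℕ} (hN : 2 ≤ N) : (binaryGraph N).Connected := by
  have h0 : 0 < Nat.clog 2 N := Nat.clog_pos one_lt_two hN
  have h : ∀ x, (binaryGraph N).Reachable (Sum.inl ⟨1, hN⟩) x := by
    have hadj : (binaryGraph N).Adj (Sum.inl ⟨1, hN⟩) (Sum.inr ⟨0, h0⟩) := by
      simp [binaryGraph]
    rintro (k | i)
    · by_cases hk : ⟨1, hN⟩ = k
      · rw [hk]
      · exact SimpleGraph.Adj.reachable hk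
    · by_cases hi : ⟨0, h0⟩ = i
      · rw [← hi]
        exact hadj.reachable
      · exact hadj.reachable.trans (SimpleGraph.Adj.reachable hi)
  exact SimpleGraph.Connected.mk (fun x y => (h x).symm.trans (h y))
    (nonempty := ⟨Sum.inl ⟨1, hN⟩⟩)

open Classical in
theorem card_binaryGraph_zeros (N : ℕ) :
    Fintype.card {i : Fin N ⊕ Fin (Nat.clog 2 N) //
      Sum.elim (fun k : Fin N => if AtMostTwoBits k then 1 else 0)
        (fun _ : Fin (Nat.clog 2 N) => 1) i = 0} = Nat.count (fun k => ¬ AtMostTwoBits k) N := by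
  let _ : Fintype {k // k < N ∧ ¬ AtMostTwoBits k} := Nat.CountSet.fintype _ N
  rw [Nat.count_eq_card_fintype]
  symm
  refine Fintype.card_of_bijective (α := {k // k < N ∧ ¬ AtMostTwoBits k})
    (f := fun k => ⟨Sum.inl ⟨k.1, k.2.1⟩, by simp [k.2.2]⟩) ⟨?_, ?_⟩
  · intro k l h
    simpa [Subtype.ext_iff] using h
  · rintro ⟨k | i, h⟩
    · exact ⟨⟨k, k.2, by simpa using h⟩, rfl⟩
    · simp at h

/-- The numbers `8 * j + 7` have ones in positions `0`, `1` and `2`, which two exponents `b`, `c`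
cannot cover. -/
theorem infinite_not_atMostTwoBits :
    (Set.ofPred fun k => ¬ AtMostTwoBits k).Infinite := by
  refine Set.infinite_of_injective_forall_mem (f := fun j : ℕ => 8 * j + 7)
    (fun a b h => by simpa using h) fun j => ?_
  rintro (h | ⟨b, c, h⟩)
  · omega
  · have hbit : ∀ i < 3, (8 * j + 7).testBit i = true := by
      intro i hi
      have : (8 * j + 7) % 2 ^ 3 = 7 := by omega
      have h2 := Nat.testBit_mod_two_pow (8 * j + 7) 3 i
      rw [this] at h2
      have h7 : Nat.testBit 7 i = true := by interval_cases i <;> rfl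
      rw [h7] at h2
      simpa [hi] using h2.symm
    rw [h] at hbit
    simp only [Nat.testBit_or, Nat.testBit_two_pow, Bool.or_eq_true, decide_eq_true_eq] at hbit
    have h0 := hbit 0
    have h1 := hbit 1
    have h2 := hbit 2
    omega

/-! ### The realization theorem -/

theorem binaryNullity_eq {N : ℕ} (hN : 2 ≤ N) [DecidablePred fun k => ¬ AtMostTwoBits k] :
    binaryNullity N = Nat.count (fun k => ¬ AtMostTwoBits k) N := by
  classical
  rw [binaryNullity, nullity_eq_of_isDiagonal _ (isDiagonal_rowLattice_binaryGraph hN),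
    card_binaryGraph_zeros]
  congr

/-- Take for `N` the number with at least three ones that has exactly `r` such numbers below it. It
is at least `2` because `0` and `1` have at most one bit. -/
theorem exists_binaryNullity_eq (r : ℕ) : ∃ N, 2 ≤ N ∧ binaryNullity N = r := by
  classical
  have hinf := infinite_not_atMostTwoBits
  have hN : 2 ≤ Nat.nth (fun k => ¬ AtMostTwoBits k) r := by
    have hmem : ¬ AtMostTwoBits _ := Nat.nth_mem_of_infinite hinf r
    by_contra! hlt
    refine hmem ?_
    interval_cases h : Nat.nth (fun k => ¬ AtMostTwoBits k) r
    · exact Or.inl rfl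
    · exact Or.inr ⟨0, 0, rfl⟩
  exact ⟨_, hN, by rw [binaryNullity_eq hN, Nat.count_nth_of_infinite hinf]⟩

/-- The diagonal entries belonging to a disjoint union of crown graphs. -/
def crownDivisors {n : ℕ} (d : Fin n → ℕ) : (Σ i, Fin (d i + 2) ⊕ Fin (d i + 2)) → ℕ :=
  fun v => if v.2 = Sum.inl 0 then d v.1 else 1

theorem isDiagonal_rowLattice_crowns {n : ℕ} {d : Fin n → ℕ} (hd : ∀ i, 2 ≤ d i) :
    IsDiagonal (rowLattice (disjointUnion fun i => crownGraph (d i + 2))) (crownDivisors d) :=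
  IsDiagonal.sigma (fun i => isDiagonal_rowLattice_crownGraph (one_le_two.trans (hd i)))
    (mem_rowLattice_disjointUnion _)

theorem one_mem_rowLattice_crowns {n : ℕ} {d : Fin n → ℕ} (hd : ∀ i, 2 ≤ d i) :
    1 ∈ rowLattice (disjointUnion fun i => crownGraph (d i + 2)) :=
  (mem_rowLattice_disjointUnion _ _).2 fun i =>
    one_mem_rowLattice_crownGraph (one_le_two.trans (hd i))

/-- This is the disjoint pair that the pyramid lemma needs, and the reason why the pyramid
statements assume `n` positive. -/
theorem closedNbhd_inter_crowns {n : ℕ} (d : Fin n → ℕ) (i : Fin n) :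
    closedNbhd (disjointUnion fun i => crownGraph (d i + 2)) ⟨i, Sum.inl 0⟩ ∩
      closedNbhd (disjointUnion fun i => crownGraph (d i + 2)) ⟨i, Sum.inr 0⟩ = ∅ := by
  rw [closedNbhd_disjointUnion, closedNbhd_disjointUnion, ← Set.image_inter sigma_mk_injective,
    closedNbhd_inl_inter_inr_crownGraph, Set.image_empty]

theorem crownDivisors_ne_zero {n : ℕ} {d : Fin n → ℕ} (hd : ∀ i, 2 ≤ d i)
    (v : Σ i, Fin (d i + 2) ⊕ Fin (d i + 2)) : crownDivisors d v ≠ 0 := by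
  have := hd v.1
  unfold crownDivisors
  split <;> omega

theorem crownDivisors_ne_one_iff {n : ℕ} {d : Fin n → ℕ} (hd : ∀ i, 2 ≤ d i)
    (v : Σ i, Fin (d i + 2) ⊕ Fin (d i + 2)) :
    crownDivisors d v ≠ 1 ↔ ∃ i, (⟨i, Sum.inl 0⟩ : Σ i, Fin (d i + 2) ⊕ Fin (d i + 2)) = v := by
  obtain ⟨i, v⟩ := v
  have := hd i
  constructor
  · intro h
    by_cases hv : v = Sum.inl 0
    · exact ⟨i, by rw [hv]⟩
    · simp [crownDivisors, hv] at h
  · rintro ⟨j, hj⟩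
    cases hj
    simp only [crownDivisors, if_true]
    omega

theorem card_le_card_rows (V : Type) [Fintype V] : Fintype.card V ≤ Fintype.card (V ⊕ V × V) := by
  rw [Fintype.card_sum]
  exact Nat.le_add_right _ _

theorem binaryGraph_elementaryDivisors {N : ℕ} (hN : 2 ≤ N) (d : Fin 0 → ℕ) :
    HasNontrivialNonzeroElementaryDivisors (raMatrix (binaryGraph N)) (List.ofFn d) := by
  classical
  refine hasNontrivialNonzeroElementaryDivisors_of_isDiagonal _ (card_le_card_rows _)
    (isDiagonal_rowLattice_binaryGraph hN) d (fun i => i.elim0) (fun i => i.elim0)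
    (fun i => i.elim0) (fun i => i.elim0) ?_
  rintro (k | i)
  · by_cases h : AtMostTwoBits k <;> simp [h]
  · simp

theorem pyramid_crowns {n : ℕ} (hn : 0 < n) {d : Fin n → ℕ} (hd : ∀ i, 2 ≤ d i)
    (hdvd : ∀ i j : Fin n, i ≤ j → d i ∣ d j) :
    nullity (raMatrix (pyramid (disjointUnion fun i => crownGraph (d i + 2)))) = 0 ∧
      HasNontrivialNonzeroElementaryDivisors
        (raMatrix (pyramid (disjointUnion fun i => crownGraph (d i + 2)))) (List.ofFn d) := by
  have hdiag : IsDiagonal (rowLattice (pyramid (disjointUnion fun i => crownGraph (d i + 2)))) _ :=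
    isDiagonal_top.sum (isDiagonal_rowLattice_crowns hd) fun x => by
      rw [mem_rowLattice_pyramid _ (one_mem_rowLattice_crowns hd)
        (closedNbhd_inter_crowns d ⟨0, hn⟩)]
      simp
  constructor
  · rw [nullity_eq_of_isDiagonal _ hdiag, Fintype.card_eq_zero_iff]
    refine ⟨?_⟩
    rintro ⟨t | v, h⟩
    · simp at h
    · exact crownDivisors_ne_zero hd v h
  · refine hasNontrivialNonzeroElementaryDivisors_of_isDiagonal _ (card_le_card_rows _) hdiag d
      hdvd (fun i => Sum.inr ⟨i, Sum.inl 0⟩) (fun i j h => ?_) (fun i => ?_) ?_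
    · exact congrArg Sigma.fst (Sum.inr_injective h)
    · simp [crownDivisors]
    · rintro (t | v)
      · simp
      · simpa [crownDivisors_ne_zero hd] using crownDivisors_ne_one_iff hd v

theorem pyramid_crowns_sum_binaryGraph {n : ℕ} (hn : 0 < n) {d : Fin n → ℕ} (hd : ∀ i, 2 ≤ d i)
    (hdvd : ∀ i j : Fin n, i ≤ j → d i ∣ d j) {N : ℕ} (hN : 2 ≤ N) :
    nullity (raMatrix (pyramid
        ((disjointUnion fun i => crownGraph (d i + 2)) ⊕g binaryGraph N))) = binaryNullity N ∧
      HasNontrivialNonzeroElementaryDivisors (raMatrix (pyramid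
        ((disjointUnion fun i => crownGraph (d i + 2)) ⊕g binaryGraph N))) (List.ofFn d) := by
  classical
  have hdiag : IsDiagonal (rowLattice (pyramid
      ((disjointUnion fun i => crownGraph (d i + 2)) ⊕g binaryGraph N))) _ :=
    isDiagonal_top.sum ((isDiagonal_rowLattice_crowns hd).sum
      (isDiagonal_rowLattice_binaryGraph hN) (mem_rowLattice_sum _ _)) fun x => by
      rw [mem_rowLattice_pyramid _ ((mem_rowLattice_sum _ _ _).2
        ⟨one_mem_rowLattice_crowns hd, one_mem_rowLattice_binaryGraph hN⟩)
        (a := Sum.inl ⟨⟨0, hn⟩, Sum.inl 0⟩) (b := Sum.inl ⟨⟨0, hn⟩, Sum.inr 0⟩)]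
      · simp
      · rw [closedNbhd_sum_inl, closedNbhd_sum_inl, ← Set.image_inter Sum.inl_injective,
          closedNbhd_inter_crowns, Set.image_empty]
  constructor
  · rw [nullity_eq_of_isDiagonal _ hdiag, binaryNullity,
      nullity_eq_of_isDiagonal _ (isDiagonal_rowLattice_binaryGraph hN)]
    symm
    refine Fintype.card_of_bijective
      (f := fun i => ⟨Sum.inr (Sum.inr i.1), i.2⟩) ⟨fun i j h => ?_, ?_⟩
    · simpa [Subtype.ext_iff] using h
    · rintro ⟨t | v | v, h⟩
      · simp at h
      · exact absurd h (crownDivisors_ne_zero hd v)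
      · exact ⟨⟨v, h⟩, rfl⟩
  · refine hasNontrivialNonzeroElementaryDivisors_of_isDiagonal _ (card_le_card_rows _) hdiag d
      hdvd (fun i => Sum.inr (Sum.inl ⟨i, Sum.inl 0⟩)) (fun i j h => ?_) (fun i => ?_) ?_
    · exact congrArg Sigma.fst (Sum.inl_injective (Sum.inr_injective h))
    · simp [crownDivisors]
    · rintro (t | v | k | i)
      · simp
      · simpa [crownDivisors_ne_zero hd] using crownDivisors_ne_one_iff hd v
      · by_cases h : AtMostTwoBits k <;> simp [h]
      · simp

end RAGraph

theorem mainTheorem1 (n : ℕ) (d : Fin n → ℕ) (hd : ∀ i, 2 ≤ d i)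
    (hdvd : ∀ i j : Fin n, i ≤ j → d i ∣ d j) (r : ℕ) :
    -- there is a (finite, connected) graph with the prescribed nullity and elementary divisors
    (∃ (V : Type) (_ : Fintype V) (_ : DecidableEq V) (Γ : SimpleGraph V), Γ.Connected ∧
      RAGraph.nullity (RAGraph.raMatrix Γ) = r ∧
      RAGraph.HasNontrivialNonzeroElementaryDivisors (RAGraph.raMatrix Γ) (List.ofFn d)) ∧
    -- the number `r` is the nullity of the RA matrix of some binary graph
    (∃ N : ℕ, 2 ≤ N ∧ RAGraph.binaryNullity N = r) ∧
    -- the pyramid over the crown graphs `Cr(2 d_i + 4)` and any such binary graph is such a graph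
    (0 < n → ∀ N : ℕ, 2 ≤ N → RAGraph.binaryNullity N = r →
      RAGraph.nullity (RAGraph.raMatrix (RAGraph.pyramid
        (RAGraph.disjointUnion (fun i : Fin n => RAGraph.crownGraph (d i + 2)) ⊕g
          RAGraph.binaryGraph N))) = r ∧
      RAGraph.HasNontrivialNonzeroElementaryDivisors (RAGraph.raMatrix (RAGraph.pyramid
        (RAGraph.disjointUnion (fun i : Fin n => RAGraph.crownGraph (d i + 2)) ⊕g
          RAGraph.binaryGraph N))) (List.ofFn d)) ∧
    -- for `r = 0` the binary graph may be left out
    (0 < n → r = 0 →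
      RAGraph.nullity (RAGraph.raMatrix (RAGraph.pyramid
        (RAGraph.disjointUnion (fun i : Fin n => RAGraph.crownGraph (d i + 2))))) = 0 ∧
      RAGraph.HasNontrivialNonzeroElementaryDivisors (RAGraph.raMatrix (RAGraph.pyramid
        (RAGraph.disjointUnion (fun i : Fin n => RAGraph.crownGraph (d i + 2))))) (List.ofFn d)) := by
  obtain ⟨N, hN, hr⟩ := RAGraph.exists_binaryNullity_eq r
  refine ⟨?_, ⟨N, hN, hr⟩, fun hn N hN hr => ?_, fun hn _ => RAGraph.pyramid_crowns hn hd hdvd⟩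
  -- With no crown to supply disjoint neighborhoods, the case `n = 0` uses `Bg(N)` without an apex:
  -- it is already connected, and all its diagonal entries are `0` or `1`.
  · rcases Nat.eq_zero_or_pos n with rfl | hn
    · exact ⟨_, inferInstance, inferInstance, RAGraph.binaryGraph N,
        RAGraph.binaryGraph_connected hN, hr, RAGraph.binaryGraph_elementaryDivisors hN d⟩
    · obtain ⟨h1, h2⟩ := RAGraph.pyramid_crowns_sum_binaryGraph hn hd hdvd hN
      exact ⟨_, inferInstance, inferInstance, _, RAGraph.pyramid_connected _, h1.trans hr, h2⟩
  · obtain ⟨h1, h2⟩ := RAGraph.pyramid_crowns_sum_binaryGraph hn hd hdvd hN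
    exact ⟨h1.trans hr, h2⟩
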